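/- Let $\Omega$ be a locally compact Hausdorff space and let $E$, $F$ be Hilbert $C_0(\Omega)$-modules (complete, with inner products linear in the second variable). For $\omega\in\Omega$ put $K^E_\omega=\{e\in E:\langle e,e\rangle(\omega)=0\}$ and let $\Xi^E_\omega=E/K^E_\omega$ be the fibre at $\omega$, with inner product induced by $(e,g)\mapsto\langle e,g\rangle(\omega)$; write $e(\omega)$ for the class of $e$ in $\Xi^E_\omega$, and similarly for $F$. Let $\Omega_E=\{\omega\in\Omega:\Xi^E_\omega\neq 0\}$. For an open set $U\subseteq\Omega$ let $E_U=\{e\in E: e(\omega)=0\ \text{for all}\ \omega\in\Omega\setminus U\}$, a module over $C_0(U)$, which is identified (through extension by zero) with the functions in $C_0(\Omega)$ vanishing outside $U$; define $F_U$ in the same way. Let $\theta:E\to F$ be a $\mathbb{C}$-linear map, not assumed to be bounded, which is local ($ea=0$ implies $\theta(e)a=0$, for $e\in E$ and $a\in C_0(\Omega)$) and orthogonality preserving ($\langle x,y\rangle=0$ implies $\langle\theta(x),\theta(y)\rangle=0$, for $x,y\in E$). Let $\Omega_\theta=\{\omega\in\Omega:\theta(e)(\omega)\neq0\text{ for some }e\in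 E\}$, which is an open subset of $\Omega$. Then: (a) $\theta$ is a bounded $C_0(\Omega)$-module homomorphism. (b) There is a bounded function $\varphi:\Omega\to[0,\infty)$, continuous on $\Omega_E$, such that $\langle\theta(e),\theta(g)\rangle(\omega)=\varphi(\omega)\,\langle e,g\rangle(\omega)$ for all $e,g\in E$ and $\omega\in\Omega$. (c) There exist a bounded continuous function $\psi_0:\Omega_\theta\to(0,\infty)$ and a bounded $C_0(\Omega_\theta)$-module homomorphism $J:E_{\Omega_\theta}\to F_{\Omega_\theta}$ such that for every $\omega\in\Omega_\theta$ there is a linear isometry $J_\omega:\Xi^E_\omega\to\Xi^F_\omega$ with $J_\omega(g(\omega))=J(g)(\omega)$ for all $g\in E_{\Omega_\theta}$ (the fibre map of $J$), and $$\theta(e)(\omega)=\psi_0(\omega)\,J_\omega(e(\omega))\qquad\text{for all }e\in E,\ \omega\in\Omega_\theta .$$ -/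

import Mathlib

open scoped ZeroAtInfty ComplexOrder BoundedContinuousFunction
open TopologicalSpace

noncomputable section

namespace HilbertC0

section General

variable (A : Type*) {E F : Type*} [NormedAddCommGroup E] [NormedSpace ℂ E]
  [NormedAddCommGroup F] [NormedSpace ℂ F] [SMul A E] [SMul A F]

/-- `θ` is local: `e a = 0` implies `θ(e) a = 0`. -/
def IsLocalMap (θ : E →ₗ[ℂ] F) : Prop :=
  ∀ (e : E) (a : A), a • e = 0 → a • θ e = 0

/-- `θ` preserves orthogonality with respect to the `A`-valued inner products. -/
def IsOrthogonalityPreserving [Zero A] [Inner A E] [Inner A F] (θ : E →ₗ[ℂ] F) : Prop :=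
  ∀ x y : E, inner A x y = 0 → inner A (θ x) (θ y) = 0

/-- `T` is a bounded `A`-module homomorphism. -/
def IsBoundedModuleMap (T : E →ₗ[ℂ] F) : Prop :=
  (∃ C : ℝ, ∀ e : E, ‖T e‖ ≤ C * ‖e‖) ∧ ∀ (a : A) (e : E), T (a • e) = a • T e

end General

variable {Ω : Type*} [TopologicalSpace Ω]

/-- The pointwise order on `C₀(Ω)`, which is its order as a C⋆-algebra. -/
instance instPartialOrderC0 : PartialOrder C₀(Ω, ℂ) :=
  PartialOrder.lift (fun f : C₀(Ω, ℂ) => (f : Ω → ℂ)) DFunLike.coe_injective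

section Fibres

variable (E : Type*) [NormedAddCommGroup E] [NormedSpace ℂ E] [SMul C₀(Ω, ℂ) E]
  [CStarModule C₀(Ω, ℂ) E]

/-- The semi-inner product `(e, g) ↦ ⟨e, g⟩(ω)` on `E`. -/
@[reducible]
def preCore (ω : Ω) : PreInnerProductSpace.Core ℂ E where
  inner e g := inner C₀(Ω, ℂ) e g ω
  conj_inner_symm e g := by
    exact DFunLike.congr_fun (CStarModule.star_inner (A := C₀(Ω, ℂ)) g e) ω
  re_inner_nonneg e := by
    have h : (0 : C₀(Ω, ℂ)) ≤ inner C₀(Ω, ℂ) e e := CStarModule.inner_self_nonneg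
    have h' : (0 : ℂ) ≤ inner C₀(Ω, ℂ) e e ω := h ω
    exact (Complex.le_def.1 h').1
  add_left e g h := by
    rw [CStarModule.inner_add_left]; rfl
  smul_left e g r := by
    rw [CStarModule.inner_smul_left_complex]; rfl

variable {E}

theorem inner_apply_eq_zero_of_right {ω : Ω} (e : E) {k : E}
    (hk : inner C₀(Ω, ℂ) k k ω = 0) : inner C₀(Ω, ℂ) e k ω = 0 := by
  have h := @InnerProductSpace.Core.inner_mul_inner_self_le ℂ E _ _ _ (preCore E ω) e k
  have hs := @InnerProductSpace.Core.norm_inner_symm ℂ E _ _ _ (preCore E ω) e k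
  change ‖inner C₀(Ω, ℂ) e k ω‖ * ‖inner C₀(Ω, ℂ) k e ω‖ ≤
    RCLike.re (inner C₀(Ω, ℂ) e e ω) * RCLike.re (inner C₀(Ω, ℂ) k k ω) at h
  change ‖inner C₀(Ω, ℂ) e k ω‖ = ‖inner C₀(Ω, ℂ) k e ω‖ at hs
  rw [← hs, hk, map_zero, mul_zero] at h
  exact norm_eq_zero.1 (mul_self_eq_zero.1 (le_antisymm h (mul_self_nonneg _)))

theorem inner_apply_eq_zero_of_left {ω : Ω} {k : E} (e : E)
    (hk : inner C₀(Ω, ℂ) k k ω = 0) : inner C₀(Ω, ℂ) k e ω = 0 := by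
  have hs := @InnerProductSpace.Core.norm_inner_symm ℂ E _ _ _ (preCore E ω) e k
  change ‖inner C₀(Ω, ℂ) e k ω‖ = ‖inner C₀(Ω, ℂ) k e ω‖ at hs
  rw [inner_apply_eq_zero_of_right e hk, norm_zero] at hs
  exact norm_eq_zero.1 hs.symm

variable (E)

/-- `K_S`: the elements of `E` that vanish at every point of `S`, where `e` vanishes at `ω` if
`⟨e, e⟩(ω) = 0`. -/
def vanishingOn (S : Set Ω) : Submodule ℂ E where
  carrier := {e | ∀ ω ∈ S, inner C₀(Ω, ℂ) e e ω = 0}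
  zero_mem' ω _ := by rw [CStarModule.inner_zero_left]; rfl
  add_mem' {e g} he hg ω hω := by
    rw [CStarModule.inner_add_left, CStarModule.inner_add_right, CStarModule.inner_add_right]
    simp [he ω hω, hg ω hω, inner_apply_eq_zero_of_right e (hg ω hω),
      inner_apply_eq_zero_of_left e (hg ω hω)]
  smul_mem' c e he ω hω := by
    rw [CStarModule.inner_smul_left_complex, CStarModule.inner_smul_right_complex]
    simp [he ω hω]

/-- The fibre `Ξ_ω = E / K_ω` of the Hilbert bundle of `E`. -/
def Fibre (ω : Ω) : Type _ := E ⧸ vanishingOn E ({ω} : Set Ω)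

instance (ω : Ω) : AddCommGroup (Fibre E ω) :=
  inferInstanceAs (AddCommGroup (E ⧸ vanishingOn E ({ω} : Set Ω)))

instance (ω : Ω) : Module ℂ (Fibre E ω) :=
  inferInstanceAs (Module ℂ (E ⧸ vanishingOn E ({ω} : Set Ω)))

variable {E}

/-- The value `e(ω)` of the section `e` at `ω`, that is, the class of `e` in `E / K_ω`. -/
def value (ω : Ω) : E →ₗ[ℂ] Fibre E ω := (vanishingOn E ({ω} : Set Ω)).mkQ

theorem value_surjective (ω : Ω) : Function.Surjective (value (E := E) ω) :=
  Submodule.mkQ_surjective _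

theorem value_eq_zero_iff {ω : Ω} {e : E} : value ω e = 0 ↔ inner C₀(Ω, ℂ) e e ω = 0 := by
  have h : value ω e = 0 ↔ e ∈ vanishingOn E ({ω} : Set Ω) := Submodule.Quotient.mk_eq_zero _
  rw [h]
  exact ⟨fun h => h ω rfl, fun h ω' hω' => by rw [Set.mem_singleton_iff.1 hω']; exact h⟩

theorem value_eq_value_iff {ω : Ω} {e g : E} :
    value ω e = value ω g ↔ inner C₀(Ω, ℂ) (e - g) (e - g) ω = 0 := by
  rw [← value_eq_zero_iff, map_sub, sub_eq_zero]

theorem inner_apply_congr {ω : Ω} {e e' g g' : E} (he : value ω e = value ω e')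
    (hg : value ω g = value ω g') :
    inner C₀(Ω, ℂ) e g ω = inner C₀(Ω, ℂ) e' g' ω := by
  have h1 := inner_apply_eq_zero_of_left g (value_eq_value_iff.1 he)
  have h2 := inner_apply_eq_zero_of_right e' (value_eq_value_iff.1 hg)
  rw [CStarModule.inner_sub_left, ZeroAtInftyContinuousMap.sub_apply, sub_eq_zero] at h1
  rw [CStarModule.inner_sub_right, ZeroAtInftyContinuousMap.sub_apply, sub_eq_zero] at h2
  rw [h1, h2]

variable (E)

/-- The inner product of the fibre, `⟨e(ω), g(ω)⟩ = ⟨e, g⟩(ω)`; see `fibreInner_value`. -/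
def fibreInner (ω : Ω) (ξ η : Fibre E ω) : ℂ :=
  inner C₀(Ω, ℂ) (Function.surjInv (value_surjective ω) ξ)
    (Function.surjInv (value_surjective ω) η) ω

variable {E}

theorem fibreInner_value (ω : Ω) (e g : E) :
    fibreInner E ω (value ω e) (value ω g) = inner C₀(Ω, ℂ) e g ω :=
  inner_apply_congr (Function.surjInv_eq _ _) (Function.surjInv_eq _ _)

variable (E)

@[reducible]
def fibreCore (ω : Ω) : InnerProductSpace.Core ℂ (Fibre E ω) where
  inner := fibreInner E ω
  conj_inner_symm ξ η := by
    obtain ⟨e, rfl⟩ := value_surjective ω ξ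
    obtain ⟨g, rfl⟩ := value_surjective ω η
    change (starRingEnd ℂ) (fibreInner E ω _ _) = fibreInner E ω _ _
    rw [fibreInner_value, fibreInner_value]
    exact (preCore E ω).conj_inner_symm e g
  re_inner_nonneg ξ := by
    obtain ⟨e, rfl⟩ := value_surjective ω ξ
    rw [fibreInner_value]
    exact (preCore E ω).re_inner_nonneg e
  add_left ξ η ζ := by
    obtain ⟨e, rfl⟩ := value_surjective ω ξ
    obtain ⟨g, rfl⟩ := value_surjective ω η
    obtain ⟨h, rfl⟩ := value_surjective ω ζ
    change fibreInner E ω _ _ = fibreInner E ω _ _ + fibreInner E ω _ _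
    rw [← map_add, fibreInner_value, fibreInner_value, fibreInner_value]
    exact (preCore E ω).add_left e g h
  smul_left ξ η r := by
    obtain ⟨e, rfl⟩ := value_surjective ω ξ
    obtain ⟨g, rfl⟩ := value_surjective ω η
    change fibreInner E ω _ _ = (starRingEnd ℂ) r * fibreInner E ω _ _
    rw [← map_smul, fibreInner_value, fibreInner_value]
    exact (preCore E ω).smul_left e g r
  definite ξ h := by
    obtain ⟨e, rfl⟩ := value_surjective ω ξ
    change fibreInner E ω _ _ = 0 at h
    rw [fibreInner_value] at h
    exact value_eq_zero_iff.2 h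

instance (ω : Ω) : NormedAddCommGroup (Fibre E ω) := (fibreCore E ω).toNormedAddCommGroup

instance (ω : Ω) : InnerProductSpace ℂ (Fibre E ω) :=
  InnerProductSpace.ofCore (fibreCore E ω).toCore

variable (Ω)

/-- `Ω_E`: the points whose fibre is non-zero. -/
def nonzeroFibres : Set Ω := {ω | Nontrivial (Fibre E ω)}

end Fibres

section Restriction

variable [T2Space Ω]

/-- Extension by zero `C₀(U) → C₀(Ω)` for an open set `U`, through which `C₀(U)` is identified
with the functions in `C₀(Ω)` that vanish outside `U`. -/
def extendZero (U : Opens Ω) (f : C₀(U, ℂ)) : C₀(Ω, ℂ) :=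
  have small : ∀ ε > 0, ∃ K : Set Ω, IsCompact K ∧ K ⊆ U ∧
      ∀ ω ∉ K, ‖Function.extend (Subtype.val : U → Ω) f 0 ω‖ < ε := by
    intro ε hε
    have h : ∀ᶠ x in Filter.cocompact U, ‖f x‖ < ε := by
      have := (zero_at_infty f).norm
      rw [norm_zero] at this
      exact this.eventually (gt_mem_nhds hε)
    obtain ⟨K, hK, hKs⟩ := Filter.mem_cocompact.1 h
    refine ⟨Subtype.val '' K, hK.image continuous_subtype_val, by rintro _ ⟨x, _, rfl⟩; exact x.2,
      fun ω hω => ?_⟩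
    by_cases hU : ω ∈ U
    · have := Subtype.val_injective.extend_apply f (0 : Ω → ℂ) (⟨ω, hU⟩ : U)
      rw [show ω = ((⟨ω, hU⟩ : U) : Ω) from rfl, this]
      exact hKs fun hx => hω ⟨_, hx, rfl⟩
    · rw [Function.extend_apply' _ _ _ (by rintro ⟨x, rfl⟩; exact hU x.2)]
      simpa using hε
  { toFun := Function.extend (Subtype.val : U → Ω) f 0
    continuous_toFun := by
      rw [continuous_iff_continuousAt]
      intro ω
      by_cases hU : ω ∈ U
      · have ho : Topology.IsOpenEmbedding (Subtype.val : U → Ω) :=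
          U.isOpen.isOpenEmbedding_subtypeVal
        refine (ho.continuousAt_iff (x := (⟨ω, hU⟩ : U))).1 ?_
        rw [Function.extend_comp Subtype.val_injective]
        exact (map_continuous f).continuousAt
      · have h0 : Function.extend (Subtype.val : U → Ω) f 0 ω = 0 :=
          Function.extend_apply' _ _ _ (by rintro ⟨x, rfl⟩; exact hU x.2)
        rw [ContinuousAt, h0, Metric.tendsto_nhds]
        intro ε hε
        obtain ⟨K, hK, hKU, hKs⟩ := small ε hε
        filter_upwards [hK.isClosed.isOpen_compl.mem_nhds fun h => hU (hKU h)] with x hx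
        simpa using hKs x hx
    zero_at_infty' := by
      rw [Metric.tendsto_nhds]
      intro ε hε
      obtain ⟨K, hK, -, hKs⟩ := small ε hε
      filter_upwards [hK.compl_mem_cocompact] with x hx
      simpa using hKs x hx }

theorem extendZero_apply (U : Opens Ω) (f : C₀(U, ℂ)) (ω : U) : extendZero U f ω = f ω :=
  Subtype.val_injective.extend_apply _ _ _

theorem extendZero_apply_of_notMem (U : Opens Ω) (f : C₀(U, ℂ)) {ω : Ω} (hω : ω ∉ U) :
    extendZero U f ω = 0 :=
  Function.extend_apply' _ _ _ (by rintro ⟨x, rfl⟩; exact hω x.2)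

variable (E : Type*) [NormedAddCommGroup E] [NormedSpace ℂ E] [SMul C₀(Ω, ℂ) E]
  [CStarModule C₀(Ω, ℂ) E]

/-- `E_U`: the `C₀`-sections over the open set `U`, identified with the elements of `E` that
vanish outside `U`. -/
abbrev restrict (U : Opens Ω) : Submodule ℂ E := vanishingOn E (U : Set Ω)ᶜ

/-- The action of `C₀(U)` on `E_U`: the section `f • e` has the value `f(ω) e(ω)` at `ω ∈ U`. -/
instance (U : Opens Ω) : SMul C₀(U, ℂ) (restrict E U) where
  smul f e := ⟨extendZero U f • (e : E), fun ω hω => by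
    rw [CStarModule.inner_op_smul_right, CStarModule.inner_op_smul_left]
    simp [e.2 ω hω]⟩

theorem coe_smul_restrict (U : Opens Ω) (f : C₀(U, ℂ)) (e : restrict E U) :
    ((f • e : restrict E U) : E) = extendZero U f • (e : E) := rfl

end Restriction

section Support

variable (Ω) {E F : Type*} [NormedAddCommGroup E] [NormedSpace ℂ E]
  [NormedAddCommGroup F] [NormedSpace ℂ F] [SMul C₀(Ω, ℂ) F] [CStarModule C₀(Ω, ℂ) F]

/-- `Ω_θ`: the open set of points `ω` with `θ(e)(ω) ≠ 0` for some `e`. -/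
def nonzeroSet (θ : E →ₗ[ℂ] F) : Opens Ω where
  carrier := {ω | ∃ e : E, value ω (θ e) ≠ 0}
  is_open' := by
    have : {ω : Ω | ∃ e : E, value ω (θ e) ≠ 0} =
        ⋃ e : E, {ω | inner C₀(Ω, ℂ) (θ e) (θ e) ω ≠ 0} := by
      ext ω
      simp [value_eq_zero_iff]
    rw [this]
    exact isOpen_iUnion fun e => isOpen_ne_fun (map_continuous _) continuous_const

end Support

end HilbertC0

end

/-!
A local map is the identity on patches: if `h = c • e` near `ω` then `θ(h)(ω) = c θ(e)(ω)`. Given a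
section `e`, choose step functions of `‖e(ω)‖` that stay comparable to `‖e(ω)‖ ^ (-1/2)`; their
product with `e` is again a section `h`, and on each plateau `‖θ(h)‖` bounds the step times
`‖θ(e)(ω)‖`. Two staircases whose plateaus cover the line give `‖θ(e)(ω)‖ ≤ M √‖e(ω)‖`, so `θ` acts
on the fibres and is `C₀(Ω)`-linear. The action on a fibre preserves orthogonality, hence is a
multiple `ψ(ω)` of an isometry, and the closed graph theorem bounds `θ`, hence also `ψ`. Finally `J`
is `ψ⁻¹ θ`, which is defined on sections vanishing outside `Ω_θ`, where `ψ` has no zero.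
-/

namespace HilbertC0

open Filter Set Topology

section InnerProductSpace

variable {𝕜 H K : Type*} [RCLike 𝕜] [NormedAddCommGroup H] [InnerProductSpace 𝕜 H]
  [NormedAddCommGroup K] [InnerProductSpace 𝕜 K]

theorem inner_map_map_of_norm_map_eq_mul {T : H →ₗ[𝕜] K} {c : ℝ} (hT : ∀ x, ‖T x‖ = c * ‖x‖)
    (x y : H) : inner 𝕜 (T x) (T y) = (c : 𝕜) ^ 2 * inner 𝕜 x y := by
  rw [inner_eq_sum_norm_sq_div_four, inner_eq_sum_norm_sq_div_four x y]
  simp only [← map_add, ← map_sub, ← map_smul, hT]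
  push_cast
  ring

theorem norm_map_mul_norm_comm {T : H →ₗ[𝕜] K}
    (hT : ∀ x y, inner 𝕜 x y = 0 → inner 𝕜 (T x) (T y) = 0) (x y : H) :
    ‖T x‖ * ‖y‖ = ‖T y‖ * ‖x‖ := by
  -- `⟪x, x⟫ y - ⟪x, y⟫ x` is orthogonal to `x`
  have inner_comm (x y : H) :
      inner 𝕜 x x * inner 𝕜 (T x) (T y) = inner 𝕜 x y * inner 𝕜 (T x) (T x) := by
    have h := hT x (inner 𝕜 x x • y - inner 𝕜 x y • x) (by
      rw [inner_sub_right, inner_smul_right, inner_smul_right, mul_comm, sub_self])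
    rwa [map_sub, map_smul, map_smul, inner_sub_right, inner_smul_right, inner_smul_right,
      sub_eq_zero] at h
  have norm_comm (x y : H) :
      ‖x‖ ^ 2 * ‖inner 𝕜 (T x) (T y)‖ = ‖inner 𝕜 x y‖ * ‖T x‖ ^ 2 := by
    simpa [inner_self_eq_norm_sq_to_K] using congrArg norm (inner_comm x y)
  have of_inner_ne_zero {x y : H} (hxy : inner 𝕜 x y ≠ 0) : ‖T x‖ * ‖y‖ = ‖T y‖ * ‖x‖ := by
    have hyx := norm_comm y x
    rw [norm_inner_symm, norm_inner_symm y x] at hyx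
    refine (sq_eq_sq₀ (by positivity) (by positivity)).1
      (mul_left_cancel₀ (norm_ne_zero_iff.2 hxy) ?_)
    linear_combination ‖x‖ ^ 2 * hyx - ‖y‖ ^ 2 * norm_comm x y
  rcases eq_or_ne x 0 with rfl | hx
  · simp
  rcases eq_or_ne y 0 with rfl | hy
  · simp
  by_cases hxy : inner 𝕜 x y = 0
  · have hxz : inner 𝕜 x (x + y) ≠ 0 := by simpa [inner_add_right, hxy] using hx
    have hyz : inner 𝕜 y (x + y) ≠ 0 := by
      simpa [inner_add_right, inner_eq_zero_symm.1 hxy] using hy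
    have hz : x + y ≠ 0 := fun h => hxz (by rw [h, inner_zero_right])
    refine mul_right_cancel₀ (norm_ne_zero_iff.2 hz) ?_
    linear_combination ‖y‖ * of_inner_ne_zero hxz - ‖x‖ * of_inner_ne_zero hyz
  · exact of_inner_ne_zero hxy

theorem exists_norm_map_eq_mul {T : H →ₗ[𝕜] K}
    (hT : ∀ x y, inner 𝕜 x y = 0 → inner 𝕜 (T x) (T y) = 0) :
    ∃ c : ℝ, 0 ≤ c ∧ ∀ x, ‖T x‖ = c * ‖x‖ := by
  rcases subsingleton_or_nontrivial H with _ | _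
  · exact ⟨0, le_rfl, fun x => by simp [Subsingleton.elim x 0]⟩
  · obtain ⟨e, he⟩ := exists_ne (0 : H)
    refine ⟨‖T e‖ / ‖e‖, by positivity, fun x => ?_⟩
    rw [div_mul_eq_mul_div, eq_div_iff (norm_ne_zero_iff.2 he), norm_map_mul_norm_comm hT]

end InnerProductSpace

section Staircase

/-- A continuous function `ℝ → ℝ` at bounded distance from the identity that is constant, with value
`n`, on each interval `[n, n + 2/3]`, `n : ℤ`. -/
noncomputable def staircase (s : ℝ) : ℝ := s + (max 0 (3 * Int.fract s - 2) - Int.fract s)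

theorem continuous_staircase : Continuous staircase :=
  continuous_id.add (ContinuousOn.comp_fract'' (f := fun f : ℝ => max 0 (3 * f - 2) - f)
    (by fun_prop) (by norm_num))

theorem staircase_le (s : ℝ) : staircase s ≤ s := by
  have : max 0 (3 * Int.fract s - 2) ≤ Int.fract s :=
    max_le (Int.fract_nonneg s) (by linarith [Int.fract_lt_one s])
  unfold staircase
  linarith

theorem sub_one_le_staircase (s : ℝ) : s - 1 ≤ staircase s := by
  have := le_max_left 0 (3 * Int.fract s - 2)
  unfold staircase
  linarith [Int.fract_lt_one s]

theorem staircase_eventuallyEq {n : ℤ} {s : ℝ} (hs : s ∈ Ioo (n : ℝ) (n + 2 / 3)) :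
    ∀ᶠ x in 𝓝 s, staircase x = n := by
  filter_upwards [Ioo_mem_nhds hs.1 hs.2] with x hx
  have hfloor : ⌊x⌋ = n := Int.floor_eq_iff.2 ⟨hx.1.le, by linarith [hx.2]⟩
  have hfract : Int.fract x = x - n := by rw [Int.fract, hfloor]
  rw [staircase, hfract, max_eq_left (by linarith [hx.2])]
  ring

theorem mem_Ioo_intCast_or_add_half_mem (s : ℝ) :
    (∃ n : ℤ, s ∈ Ioo (n : ℝ) (n + 2 / 3)) ∨ ∃ n : ℤ, s + 1 / 2 ∈ Ioo (n : ℝ) (n + 2 / 3) := by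
  have hle := Int.floor_le s
  have hlt := Int.lt_floor_add_one s
  rcases hle.eq_or_lt with heq | hgt
  · exact .inr ⟨⌊s⌋, by constructor <;> linarith⟩
  rcases lt_or_ge s (⌊s⌋ + 2 / 3) with h | h
  · exact .inl ⟨⌊s⌋, hgt, h⟩
  · exact .inr ⟨⌊s⌋ + 1, by push_cast; constructor <;> linarith⟩

/-- A continuous function of `t > 0` comparable to `1 / √t` that is constant on each of a sequence
of intervals accumulating at `0`; the phase `a` moves these intervals. -/
noncomputable def invSqrtStep (a t : ℝ) : ℝ := Real.exp (staircase (a - Real.log √t))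

theorem invSqrtStep_pos (a t : ℝ) : 0 < invSqrtStep a t := Real.exp_pos _

theorem continuousOn_invSqrtStep (a : ℝ) : ContinuousOn (invSqrtStep a) (Ioi 0) := by
  refine Real.continuous_exp.comp_continuousOn (continuous_staircase.comp_continuousOn ?_)
  exact continuousOn_const.sub
    (Real.continuous_sqrt.continuousOn.log fun t ht => (Real.sqrt_pos.2 ht).ne')

theorem invSqrtStep_mul_sqrt_le (a : ℝ) {t : ℝ} (ht : 0 < t) :
    invSqrtStep a t * √t ≤ Real.exp a := by
  have hsqrt := Real.sqrt_pos.2 ht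
  rw [← le_div_iff₀ hsqrt]
  calc invSqrtStep a t ≤ Real.exp (a - Real.log √t) := Real.exp_le_exp.2 (staircase_le _)
    _ = Real.exp a / √t := by rw [Real.exp_sub, Real.exp_log hsqrt]

theorem exp_le_invSqrtStep_mul_sqrt (a : ℝ) {t : ℝ} (ht : 0 < t) :
    Real.exp (a - 1) ≤ invSqrtStep a t * √t := by
  have hsqrt := Real.sqrt_pos.2 ht
  rw [← div_le_iff₀ hsqrt]
  calc Real.exp (a - 1) / √t = Real.exp (a - Real.log √t - 1) := by
        rw [sub_right_comm, Real.exp_sub _ (Real.log √t), Real.exp_log hsqrt]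
    _ ≤ invSqrtStep a t := Real.exp_le_exp.2 (sub_one_le_staircase _)

theorem tendsto_invSqrtStep_mul_self (a : ℝ) :
    Tendsto (fun t => invSqrtStep a t * t) (𝓝[>] 0) (𝓝 0) := by
  have hlim : Tendsto (fun t => Real.exp a * √t) (𝓝[>] 0) (𝓝 0) := by
    have := (Real.continuous_sqrt.tendsto 0).const_mul (Real.exp a)
    rw [Real.sqrt_zero, mul_zero] at this
    exact this.mono_left nhdsWithin_le_nhds
  refine tendsto_of_tendsto_of_tendsto_of_le_of_le' tendsto_const_nhds hlim ?_ ?_ <;>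
    filter_upwards [self_mem_nhdsWithin] with t ht
  · exact mul_nonneg (invSqrtStep_pos a t).le (le_of_lt ht)
  · calc invSqrtStep a t * t = invSqrtStep a t * √t * √t := by
          rw [mul_assoc, Real.mul_self_sqrt (le_of_lt ht)]
      _ ≤ Real.exp a * √t := by gcongr; exact invSqrtStep_mul_sqrt_le a ht

theorem invSqrtStep_eventually_const {t : ℝ} (ht : 0 < t) :
    ∃ a ∈ ({0, 1 / 2} : Set ℝ), ∀ᶠ x in 𝓝 t, invSqrtStep a x = invSqrtStep a t := by
  have hlog (a : ℝ) : ContinuousAt (fun x => a - Real.log √x) t :=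
    continuousAt_const.sub (Real.continuous_sqrt.continuousAt.log (Real.sqrt_pos.2 ht).ne')
  have of_mem {a : ℝ} {n : ℤ} (h : a - Real.log √t ∈ Ioo (n : ℝ) (n + 2 / 3)) :
      ∀ᶠ x in 𝓝 t, invSqrtStep a x = invSqrtStep a t := by
    have hn := staircase_eventuallyEq h
    filter_upwards [(hlog a).eventually hn] with x hx
    rw [invSqrtStep, invSqrtStep, hx, hn.self_of_nhds]
  rcases mem_Ioo_intCast_or_add_half_mem (-Real.log √t) with ⟨n, hn⟩ | ⟨n, hn⟩
  · exact ⟨0, by simp, of_mem (by rwa [zero_sub])⟩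
  · exact ⟨1 / 2, by simp, of_mem (by rwa [sub_eq_neg_add])⟩

end Staircase

section Values

variable {Ω E : Type*} [TopologicalSpace Ω] [NormedAddCommGroup E] [NormedSpace ℂ E]
  [SMul C₀(Ω, ℂ) E] [CStarModule C₀(Ω, ℂ) E]

theorem inner_value (ω : Ω) (e g : E) :
    inner ℂ (value ω e) (value ω g) = inner C₀(Ω, ℂ) e g ω :=
  fibreInner_value ω e g

theorem norm_value_eq_sqrt (ω : Ω) (e : E) : ‖value ω e‖ = √‖inner C₀(Ω, ℂ) e e ω‖ := by
  rw [← inner_value, inner_self_eq_norm_sq_to_K, norm_pow, RCLike.norm_ofReal, abs_norm,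
    Real.sqrt_sq (norm_nonneg _)]

theorem continuous_norm_value (e : E) : Continuous fun ω : Ω => ‖value ω e‖ := by
  simp_rw [norm_value_eq_sqrt]
  exact (map_continuous _).norm.sqrt

theorem isCompact_le_norm_value (e : E) {ε : ℝ} (hε : 0 < ε) :
    IsCompact {ω : Ω | ε ≤ ‖value ω e‖} := by
  have hlim : Tendsto (fun ω : Ω => ‖value ω e‖) (cocompact Ω) (𝓝 0) := by
    simp_rw [norm_value_eq_sqrt]
    simpa using (zero_at_infty (inner C₀(Ω, ℂ) e e)).norm.sqrt
  obtain ⟨K, hK, hKε⟩ := mem_cocompact.1 (hlim.eventually (gt_mem_nhds hε))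
  refine hK.of_isClosed_subset (isClosed_le continuous_const (continuous_norm_value e)) ?_
  exact fun ω hω => by_contra fun hωK => lt_irrefl ε (lt_of_le_of_lt hω (hKε hωK))

theorem norm_value_le (ω : Ω) (e : E) : ‖value ω e‖ ≤ ‖e‖ := by
  rw [norm_value_eq_sqrt, CStarModule.norm_eq_sqrt_norm_inner_self (A := C₀(Ω, ℂ)) e]
  exact Real.sqrt_le_sqrt ((inner C₀(Ω, ℂ) e e).toBCF.norm_coe_le_norm ω)

theorem continuous_value (ω : Ω) : Continuous (value (E := E) ω) :=
  AddMonoidHomClass.continuous_of_bound _ 1 fun e => by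
    rw [one_mul]; exact norm_value_le ω e

variable (Ω) in
theorem norm_le_of_norm_value_le {e : E} {C : ℝ} (hC : 0 ≤ C) (h : ∀ ω : Ω, ‖value ω e‖ ≤ C) :
    ‖e‖ ≤ C := by
  rw [CStarModule.norm_eq_sqrt_norm_inner_self (A := C₀(Ω, ℂ)) e, Real.sqrt_le_left hC]
  refine ((inner C₀(Ω, ℂ) e e).toBCF.norm_le (sq_nonneg C)).2 fun ω => ?_
  rw [← Real.sqrt_le_left hC]
  exact (norm_value_eq_sqrt ω e).symm.trans_le (h ω)

variable (Ω) in
theorem ext_value {e g : E} (h : ∀ ω : Ω, value ω e = value ω g) : e = g := by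
  have : ‖e - g‖ ≤ 0 := norm_le_of_norm_value_le Ω le_rfl fun ω => by
    rw [map_sub, h, sub_self, norm_zero]
  exact sub_eq_zero.1 (norm_le_zero_iff.1 this)

theorem value_smul (ω : Ω) (a : C₀(Ω, ℂ)) (e : E) : value ω (a • e) = a ω • value ω e := by
  rw [← map_smul, value_eq_value_iff]
  simp only [CStarModule.inner_sub_left, CStarModule.inner_sub_right,
    CStarModule.inner_op_smul_left, CStarModule.inner_op_smul_right,
    CStarModule.inner_smul_left_complex, CStarModule.inner_smul_right_complex,
    ZeroAtInftyContinuousMap.sub_apply, ZeroAtInftyContinuousMap.mul_apply,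
    ZeroAtInftyContinuousMap.smul_apply, ZeroAtInftyContinuousMap.star_apply, smul_eq_mul]
  ring

theorem mem_nonzeroFibres_iff {ω : Ω} : ω ∈ nonzeroFibres Ω E ↔ ∃ e : E, value ω e ≠ 0 := by
  refine (nontrivial_iff_exists_ne (0 : Fibre E ω)).trans ?_
  exact (value_surjective ω).exists

theorem mem_restrict_iff {U : Opens Ω} {e : E} :
    e ∈ restrict E U ↔ ∀ ω ∉ U, value ω e = 0 :=
  forall₂_congr fun _ _ => value_eq_zero_iff.symm

theorem exists_value_eq_of_forall_norm_sub_le [CompleteSpace E] {s : ∀ ω : Ω, Fibre E ω}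
    (h : ∀ ε > 0, ∃ x : E, ∀ ω, ‖value ω x - s ω‖ ≤ ε) : ∃ x : E, ∀ ω, value ω x = s ω := by
  obtain ⟨r, hr_anti, hr_pos, hr_lim⟩ := exists_seq_strictAnti_tendsto (0 : ℝ)
  choose x hx using fun n => h (r n) (hr_pos n)
  have hcauchy : CauchySeq x := by
    refine cauchySeq_of_le_tendsto_0 (fun N => r N + r N) (fun n m N hn hm => ?_)
      (by simpa using hr_lim.add hr_lim)
    rw [dist_eq_norm]
    refine norm_le_of_norm_value_le Ω (add_nonneg (hr_pos N).le (hr_pos N).le) fun ω => ?_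
    rw [map_sub, ← sub_sub_sub_cancel_right _ _ (s ω)]
    exact (norm_sub_le _ _).trans (add_le_add ((hx n ω).trans (hr_anti.antitone hn))
      ((hx m ω).trans (hr_anti.antitone hm)))
  obtain ⟨y, hy⟩ := cauchySeq_tendsto_of_complete hcauchy
  refine ⟨y, fun ω => tendsto_nhds_unique (((continuous_value ω).tendsto y).comp hy) ?_⟩
  exact tendsto_iff_norm_sub_tendsto_zero.2
    (squeeze_zero (fun _ => norm_nonneg _) (fun n => hx n ω) hr_lim)

end Values

section Multipliers

variable {Ω : Type*} [TopologicalSpace Ω] [LocallyCompactSpace Ω] [T2Space Ω]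

theorem exists_cutoff {U K : Set Ω} (hU : IsOpen U) (hK : IsCompact K) (hKU : K ⊆ U)
    {k : Ω → ℂ} (hk : ContinuousOn k U) :
    ∃ a : C₀(Ω, ℂ), EqOn a k K ∧ (∀ ω ∉ U, a ω = 0) ∧
      (∀ ω, ‖a ω‖ ≤ ‖k ω‖) ∧ ∀ ω, ‖a ω - k ω‖ ≤ ‖k ω‖ := by
  obtain ⟨u, hu_one, hu_compact, hu_supp, hu_mem⟩ :=
    exists_continuousMap_one_of_isCompact_subset_isOpen hK hU hKU
  have hsupp : Function.support (fun ω => (u ω : ℂ) * k ω) ⊆ Function.support u :=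
    fun ω hω h => hω (by simp [h])
  have hcont : Continuous fun ω => (u ω : ℂ) * k ω :=
    ContinuousOn.continuous_of_tsupport_subset
      ((Complex.continuous_ofReal.comp u.continuous).continuousOn.mul hk) hU
      ((closure_mono hsupp).trans hu_supp)
  have hcompact : HasCompactSupport fun ω => (u ω : ℂ) * k ω :=
    hu_compact.of_isClosed_subset (isClosed_tsupport _) (closure_mono hsupp)
  refine ⟨⟨⟨_, hcont⟩, hcompact.is_zero_at_infty⟩, fun ω hω => ?_, fun ω hω => ?_, fun ω => ?_,
    fun ω => ?_⟩
  · change (u ω : ℂ) * k ω = k ω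
    simp [hu_one hω]
  · change (u ω : ℂ) * k ω = 0
    simp [image_eq_zero_of_notMem_tsupport fun h => hω (hu_supp h)]
  · change ‖(u ω : ℂ) * k ω‖ ≤ ‖k ω‖
    rw [norm_mul, Complex.norm_of_nonneg (hu_mem ω).1]
    exact mul_le_of_le_one_left (norm_nonneg _) (hu_mem ω).2
  · change ‖(u ω : ℂ) * k ω - k ω‖ ≤ ‖k ω‖
    rw [← sub_one_mul, norm_mul, ← Complex.ofReal_one, ← Complex.ofReal_sub, Complex.norm_real]
    refine mul_le_of_le_one_left (norm_nonneg _) (abs_le.2 ?_)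
    constructor <;> linarith [(hu_mem ω).1, (hu_mem ω).2]

theorem exists_bump {U : Set Ω} {ω : Ω} (hU : U ∈ 𝓝 ω) :
    ∃ b : C₀(Ω, ℂ), b ω = 1 ∧ (∀ x ∉ U, b x = 0) ∧ ∀ x, ‖b x‖ ≤ 1 := by
  obtain ⟨b, hb_one, hb_zero, hb_le, -⟩ := exists_cutoff isOpen_interior isCompact_singleton
    (singleton_subset_iff.2 (mem_interior_iff_mem_nhds.2 hU)) (continuousOn_const (c := (1 : ℂ)))
  exact ⟨b, hb_one rfl, fun x hx => hb_zero x fun h => hx (interior_subset h),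
    fun x => (hb_le x).trans_eq norm_one⟩

variable {E : Type*} [NormedAddCommGroup E] [NormedSpace ℂ E] [CompleteSpace E]
  [SMul C₀(Ω, ℂ) E] [CStarModule C₀(Ω, ℂ) E]

theorem exists_value_eq_smul_value {U : Set Ω} (hU : IsOpen U) {k : Ω → ℂ}
    (hk : ContinuousOn k U) {e : E}
    (h : ∀ ε > 0, ∃ K ⊆ U, IsCompact K ∧ ∀ ω ∉ K, ‖k ω • value ω e‖ ≤ ε) :
    ∃ x : E, ∀ ω, value ω x = k ω • value ω e := by
  refine exists_value_eq_of_forall_norm_sub_le fun ε hε => ?_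
  obtain ⟨K, hKU, hK, hKε⟩ := h ε hε
  obtain ⟨a, ha_eq, -, -, ha_sub⟩ := exists_cutoff hU hK hKU hk
  refine ⟨a • e, fun ω => ?_⟩
  rw [value_smul, ← sub_smul]
  by_cases hω : ω ∈ K
  · rw [ha_eq hω, sub_self, zero_smul, norm_zero]
    exact hε.le
  · calc ‖(a ω - k ω) • value ω e‖ ≤ ‖k ω • value ω e‖ := by
          rw [norm_smul, norm_smul]; gcongr; exact ha_sub ω
      _ ≤ ε := hKε ω hω

theorem exists_value_eq_comp_norm_smul_value {ρ : ℝ → ℝ} (hρ : ContinuousOn ρ (Ioi 0))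
    (hρ_zero : Tendsto (fun t => ρ t * t) (𝓝[>] 0) (𝓝 0)) (e : E) :
    ∃ x : E, ∀ ω : Ω, value ω x = (ρ ‖value ω e‖ : ℂ) • value ω e := by
  have hcont : ContinuousOn (fun ω : Ω => (ρ ‖value ω e‖ : ℂ)) {ω | 0 < ‖value ω e‖} :=
    Complex.continuous_ofReal.comp_continuousOn
      (hρ.comp (continuous_norm_value e).continuousOn fun _ hω => hω)
  refine exists_value_eq_smul_value (isOpen_lt continuous_const (continuous_norm_value e)) hcont
    fun ε hε => ?_
  obtain ⟨δ, hδ, hρδ⟩ := Metric.tendsto_nhdsWithin_nhds.1 hρ_zero ε hε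
  refine ⟨_, fun ω hω => hδ.trans_le hω, isCompact_le_norm_value e hδ, fun ω hω => ?_⟩
  rcases (norm_nonneg (value ω e)).eq_or_lt with h | h
  · rw [norm_smul, ← h, mul_zero]
    exact hε.le
  · have := hρδ h (by rw [dist_zero_right, norm_norm]; exact not_le.1 hω)
    rw [dist_zero_right, norm_mul, norm_norm] at this
    rw [norm_smul, Complex.norm_real]
    exact this.le

end Multipliers

section FibreMaps

variable {Ω E F : Type*} [TopologicalSpace Ω]
  [NormedAddCommGroup E] [NormedSpace ℂ E] [SMul C₀(Ω, ℂ) E] [CStarModule C₀(Ω, ℂ) E]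
  [NormedAddCommGroup F] [NormedSpace ℂ F] [SMul C₀(Ω, ℂ) F] [CStarModule C₀(Ω, ℂ) F]
  {T : E →ₗ[ℂ] F} {ω : Ω}

/-- The map `T_ω : Ξ^E_ω → Ξ^F_ω` with `T_ω(e(ω)) = T(e)(ω)` induced by a linear map `T` for which
`T(e)(ω)` depends on `e(ω)` only. -/
def fibreMap (T : E →ₗ[ℂ] F) (ω : Ω) (hT : ∀ e, value ω e = 0 → value ω (T e) = 0) :
    Fibre E ω →ₗ[ℂ] Fibre F ω :=
  (vanishingOn E {ω}).liftQ (value ω ∘ₗ T) fun e he => hT e (value_eq_zero_iff.2 (he ω rfl))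

theorem fibreMap_value (hT : ∀ e, value ω e = 0 → value ω (T e) = 0) (e : E) :
    fibreMap T ω hT (value ω e) = value ω (T e) :=
  Submodule.liftQ_apply _ _ _

theorem value_map_eq_zero_of_norm_le {c : ℝ} (hT : ∀ e, ‖value ω (T e)‖ ≤ c * ‖value ω e‖) (e : E)
    (he : value ω e = 0) : value ω (T e) = 0 :=
  norm_le_zero_iff.1 ((hT e).trans_eq (by rw [he, norm_zero, mul_zero]))

theorem inner_map_map_apply_of_norm_eq {c : ℝ} (hT : ∀ e, ‖value ω (T e)‖ = c * ‖value ω e‖)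
    (e g : E) : inner C₀(Ω, ℂ) (T e) (T g) ω = (c : ℂ) ^ 2 * inner C₀(Ω, ℂ) e g ω := by
  have hzero := value_map_eq_zero_of_norm_le fun e => (hT e).le
  have hnorm : ∀ ξ, ‖fibreMap T ω hzero ξ‖ = c * ‖ξ‖ := (value_surjective ω).forall.2 fun e => by
    rw [fibreMap_value, hT]
  have h := inner_map_map_of_norm_map_eq_mul hnorm (value ω e) (value ω g)
  rw [fibreMap_value, fibreMap_value, inner_value, inner_value] at h
  exact h

theorem exists_linearIsometry_of_norm_eq {c : ℝ} (hc : 0 < c)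
    (hT : ∀ e, ‖value ω (T e)‖ = c * ‖value ω e‖) :
    ∃ V : Fibre E ω →ₗᵢ[ℂ] Fibre F ω, ∀ e, value ω (T e) = (c : ℂ) • V (value ω e) := by
  have hzero := value_map_eq_zero_of_norm_le fun e => (hT e).le
  refine ⟨⟨(c : ℂ)⁻¹ • fibreMap T ω hzero, (value_surjective ω).forall.2 fun e => ?_⟩, fun e => ?_⟩
  · rw [LinearMap.smul_apply, fibreMap_value, norm_smul, hT, norm_inv,
      Complex.norm_of_nonneg hc.le, inv_mul_cancel_left₀ hc.ne']
  · change value ω (T e) = (c : ℂ) • (c : ℂ)⁻¹ • fibreMap T ω hzero (value ω e)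
    rw [fibreMap_value, smul_inv_smul₀ (Complex.ofReal_ne_zero.2 hc.ne')]

theorem IsOrthogonalityPreserving.inner_map_map_apply_eq_zero
    (horth : IsOrthogonalityPreserving C₀(Ω, ℂ) T)
    (hT : ∀ e, value ω e = 0 → value ω (T e) = 0) {x y : E}
    (hxy : inner C₀(Ω, ℂ) x y ω = 0) : inner C₀(Ω, ℂ) (T x) (T y) ω = 0 := by
  by_cases hx : inner C₀(Ω, ℂ) x x ω = 0
  · exact inner_apply_eq_zero_of_left _ (value_eq_zero_iff.1 (hT x (value_eq_zero_iff.2 hx)))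
  -- `z` is orthogonal to `x` everywhere and a nonzero multiple of `y` at `ω`
  set z : E := inner C₀(Ω, ℂ) x x • y - inner C₀(Ω, ℂ) x y • x with hz
  have hxz : inner C₀(Ω, ℂ) x z = 0 := by
    rw [hz, CStarModule.inner_sub_right, CStarModule.inner_op_smul_right,
      CStarModule.inner_op_smul_right, mul_comm, sub_self]
  have hzω : value ω z = inner C₀(Ω, ℂ) x x ω • value ω y := by
    rw [hz, map_sub, value_smul, value_smul, hxy, zero_smul, sub_zero]
  have hTz : value ω (T z) = inner C₀(Ω, ℂ) x x ω • value ω (T y) := by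
    rw [← fibreMap_value hT, hzω, map_smul, fibreMap_value]
  have h : inner ℂ (value ω (T x)) (value ω (T z)) = 0 := by
    rw [inner_value, horth x z hxz]; rfl
  rw [hTz, inner_smul_right, inner_value] at h
  exact (mul_eq_zero.1 h).resolve_left hx

theorem IsOrthogonalityPreserving.exists_norm_value_map_eq_mul
    (horth : IsOrthogonalityPreserving C₀(Ω, ℂ) T)
    (hT : ∀ e, value ω e = 0 → value ω (T e) = 0) :
    ∃ c : ℝ, 0 ≤ c ∧ ∀ e, ‖value ω (T e)‖ = c * ‖value ω e‖ := by
  have hfibre : ∀ ξ η, inner ℂ ξ η = 0 →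
      inner ℂ (fibreMap T ω hT ξ) (fibreMap T ω hT η) = 0 :=
    (value_surjective ω).forall₂.2 fun x y hxy => by
      rw [inner_value] at hxy
      rw [fibreMap_value, fibreMap_value, inner_value]
      exact horth.inner_map_map_apply_eq_zero hT hxy
  obtain ⟨c, hc, hnorm⟩ := exists_norm_map_eq_mul hfibre
  exact ⟨c, hc, fun e => by rw [← fibreMap_value hT, hnorm]⟩

theorem isBoundedModuleMap_of_norm_value_le [CompleteSpace E] [CompleteSpace F]
    (hT : ∀ ω : Ω, ∃ c : ℝ, ∀ e, ‖value ω (T e)‖ ≤ c * ‖value ω e‖) :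
    IsBoundedModuleMap C₀(Ω, ℂ) T := by
  choose c hc using hT
  have hcont : Continuous T := T.continuous_of_seq_closed_graph fun u x y hu hTu =>
    ext_value Ω fun ω => by
      have hTωc : Continuous fun e : E => value ω (T e) :=
        AddMonoidHomClass.continuous_of_bound (value ω ∘ₗ T) |c ω| fun e =>
          (hc ω e).trans (mul_le_mul (le_abs_self _) (norm_value_le ω e) (norm_nonneg _)
            (abs_nonneg _))
      exact tendsto_nhds_unique (((continuous_value ω).tendsto y).comp hTu)
        ((hTωc.tendsto x).comp hu)
  refine ⟨⟨‖(⟨T, hcont⟩ : E →L[ℂ] F)‖, (⟨T, hcont⟩ : E →L[ℂ] F).le_opNorm⟩, fun a e =>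
    ext_value Ω fun ω => ?_⟩
  have hzero := value_map_eq_zero_of_norm_le (hc ω)
  rw [← fibreMap_value hzero, value_smul, value_smul, map_smul, fibreMap_value]

theorem continuousOn_of_norm_value_map_eq {ψ : Ω → ℝ}
    (hψ : ∀ ω e, ‖value ω (T e)‖ = ψ ω * ‖value ω e‖) : ContinuousOn ψ (nonzeroFibres Ω E) := by
  intro ω hω
  obtain ⟨e, he⟩ := mem_nonzeroFibres_iff.1 hω
  have he' : ‖value ω e‖ ≠ 0 := norm_ne_zero_iff.2 he
  refine ContinuousAt.continuousWithinAt (((continuous_norm_value (T e)).continuousAt.div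
    (continuous_norm_value e).continuousAt he').congr ?_)
  filter_upwards [(continuous_norm_value e).continuousAt.eventually_ne he'] with x hx
  rw [Pi.div_apply, hψ, mul_div_cancel_right₀ _ hx]

theorem nonzeroSet_subset_nonzeroFibres (hT : ∀ (ω : Ω) e, value ω e = 0 → value ω (T e) = 0) :
    (nonzeroSet Ω T : Set Ω) ⊆ nonzeroFibres Ω E :=
  fun ω ⟨e, he⟩ => mem_nonzeroFibres_iff.2 ⟨e, fun h => he (hT ω e h)⟩

end FibreMaps

section LocallyCompact

variable {Ω E F : Type*} [TopologicalSpace Ω] [LocallyCompactSpace Ω] [T2Space Ω]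
  [NormedAddCommGroup E] [NormedSpace ℂ E] [SMul C₀(Ω, ℂ) E] [CStarModule C₀(Ω, ℂ) E]
  [NormedAddCommGroup F] [NormedSpace ℂ F] [SMul C₀(Ω, ℂ) F] [CStarModule C₀(Ω, ℂ) F]
  {T : E →ₗ[ℂ] F}

theorem IsBoundedModuleMap.exists_norm_value_map_le (hT : IsBoundedModuleMap C₀(Ω, ℂ) T) :
    ∃ C : ℝ, 0 < C ∧ ∀ (ω : Ω) e, ‖value ω (T e)‖ ≤ C * ‖value ω e‖ := by
  obtain ⟨⟨B, hB⟩, hsmul⟩ := hT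
  have hC : 0 < max B 1 := lt_max_of_lt_right one_pos
  refine ⟨max B 1, hC, fun ω e => ?_⟩
  rw [← div_le_iff₀' hC]
  refine le_of_forall_gt_imp_ge_of_dense fun r hr => (div_le_iff₀' hC).2 ?_
  obtain ⟨b, hb_one, hb_zero, hb_le⟩ := exists_bump
    ((continuous_norm_value e).continuousAt.eventually_lt_const hr)
  have hr0 : 0 ≤ r := (norm_nonneg _).trans hr.le
  have hbe : ‖b • e‖ ≤ r := norm_le_of_norm_value_le Ω hr0 fun x => by
    rw [value_smul, norm_smul]
    by_cases hx : ‖value x e‖ < r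
    · exact (mul_le_of_le_one_left (norm_nonneg _) (hb_le x)).trans hx.le
    · rw [hb_zero x hx, norm_zero, zero_mul]
      exact hr0
  calc ‖value ω (T e)‖ = ‖value ω (T (b • e))‖ := by rw [hsmul, value_smul, hb_one, one_smul]
    _ ≤ ‖T (b • e)‖ := norm_value_le _ _
    _ ≤ B * ‖b • e‖ := hB _
    _ ≤ max B 1 * r := by gcongr; exact le_max_left _ _

theorem IsBoundedModuleMap.exists_scaling (hT : IsBoundedModuleMap C₀(Ω, ℂ) T)
    (horth : IsOrthogonalityPreserving C₀(Ω, ℂ) T) :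
    ∃ ψ : Ω → ℝ, (∀ ω, 0 ≤ ψ ω) ∧ (∃ C, ∀ ω, ψ ω ≤ C) ∧
      ∀ ω e, ‖value ω (T e)‖ = ψ ω * ‖value ω e‖ := by
  obtain ⟨C, hC, hTC⟩ := hT.exists_norm_value_map_le
  choose c hc hTc using fun ω =>
    horth.exists_norm_value_map_eq_mul (value_map_eq_zero_of_norm_le (hTC ω))
  -- `c ω` is arbitrary where the fibre is zero
  refine ⟨fun ω => min (c ω) C, fun ω => le_min (hc ω) hC.le, ⟨C, fun ω => min_le_right _ _⟩,
    fun ω e => ?_⟩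
  rw [min_mul_of_nonneg _ _ (norm_nonneg _), ← hTc, min_eq_left (hTC ω e)]

theorem IsBoundedModuleMap.exists_restrict_smul [CompleteSpace F]
    (hT : IsBoundedModuleMap C₀(Ω, ℂ) T) {U : Opens Ω} {k : Ω → ℂ} (hk : ContinuousOn k U) {C : ℝ}
    (hC : 0 ≤ C) (hTC : ∀ ω e, ‖k ω • value ω (T e)‖ ≤ C * ‖value ω e‖) :
    ∃ J : restrict E U →ₗ[ℂ] restrict F U, IsBoundedModuleMap C₀(U, ℂ) J ∧
      ∀ (g : restrict E U) (ω : Ω), value ω (J g : F) = k ω • value ω (T g) := by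
  have hsection (g : restrict E U) : ∃ x : F, ∀ ω : Ω, value ω x = k ω • value ω (T g) := by
    refine exists_value_eq_smul_value U.isOpen hk fun ε hε => ?_
    have hδ : 0 < ε / (C + 1) := by positivity
    refine ⟨_, fun ω hω => ?_, isCompact_le_norm_value (g : E) hδ, fun ω hω => ?_⟩
    · by_contra hωU
      exact (norm_ne_zero_iff.1 (hδ.trans_le hω).ne') (mem_restrict_iff.1 g.2 ω hωU)
    · have hlt : ‖value ω (g : E)‖ * (C + 1) < ε :=
        (lt_div_iff₀ (by positivity)).1 (not_le.1 hω)
      linarith [hTC ω g, norm_nonneg (value ω (g : E))]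
  choose j hj using hsection
  have hj_mem (g : restrict E U) : j g ∈ restrict F U := mem_restrict_iff.2 fun ω hω => by
    have := hTC ω g
    rwa [mem_restrict_iff.1 g.2 ω hω, norm_zero, mul_zero, norm_le_zero_iff, ← hj] at this
  let J : restrict E U →ₗ[ℂ] restrict F U :=
    { toFun g := ⟨j g, hj_mem g⟩
      map_add' g h := Subtype.ext <| ext_value Ω fun ω => by
        simp only [Submodule.coe_add, map_add, hj, smul_add]
      map_smul' c g := Subtype.ext <| ext_value Ω fun ω => by
        simp only [Submodule.coe_smul, map_smul, hj, RingHom.id_apply]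
        rw [smul_comm] }
  have hJ (g : restrict E U) (ω : Ω) : value ω (J g : F) = k ω • value ω (T g) := hj g ω
  refine ⟨J, ⟨⟨C, fun g => ?_⟩, fun a g => Subtype.ext <| ext_value Ω fun ω => ?_⟩, hJ⟩
  · change ‖(J g : F)‖ ≤ C * ‖(g : E)‖
    refine norm_le_of_norm_value_le Ω (by positivity) fun ω => ?_
    calc ‖value ω (J g : F)‖ ≤ C * ‖value ω (g : E)‖ := by rw [hJ]; exact hTC ω g
      _ ≤ C * ‖(g : E)‖ := by gcongr; exact norm_value_le ω (g : E)
  · rw [hJ, coe_smul_restrict, coe_smul_restrict, hT.2, value_smul, value_smul, hJ, smul_comm]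

theorem IsLocalMap.value_map_congr (hT : IsLocalMap C₀(Ω, ℂ) T) {ω : Ω} {e g : E}
    (h : ∀ᶠ x in 𝓝 ω, value x e = value x g) : value ω (T e) = value ω (T g) := by
  obtain ⟨b, hb_one, hb_zero, -⟩ := exists_bump h
  have hb : b • (e - g) = 0 := ext_value Ω fun x => by
    rw [value_smul, map_sub, map_zero]
    by_cases hx : value x e = value x g
    · rw [hx, sub_self, smul_zero]
    · rw [hb_zero x hx, zero_smul]
  have := congrArg (value ω) (hT (e - g) b hb)
  rwa [value_smul, hb_one, one_smul, map_zero, map_sub, map_sub, sub_eq_zero] at this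

theorem IsLocalMap.exists_norm_value_map_le_sqrt_of_eventually_const [CompleteSpace E]
    (hT : IsLocalMap C₀(Ω, ℂ) T) (a : ℝ) (e : E) :
    ∃ M : ℝ, ∀ ω : Ω, value ω e ≠ 0 →
      (∀ᶠ t in 𝓝 ‖value ω e‖, invSqrtStep a t = invSqrtStep a ‖value ω e‖) →
      ‖value ω (T e)‖ ≤ M * √‖value ω e‖ := by
  obtain ⟨x, hx⟩ := exists_value_eq_comp_norm_smul_value (Ω := Ω) (continuousOn_invSqrtStep a)
    (tendsto_invSqrtStep_mul_self a) e
  refine ⟨‖T x‖ / Real.exp (a - 1), fun ω hω hconst => ?_⟩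
  set t := ‖value ω e‖
  have ht : 0 < t := norm_pos_iff.2 hω
  have hTx : value ω (T x) = (invSqrtStep a t : ℂ) • value ω (T e) := by
    rw [← map_smul, ← map_smul]
    refine hT.value_map_congr ?_
    filter_upwards [(continuous_norm_value e).continuousAt.eventually hconst] with y hy
    rw [hx, hy, map_smul]
  have hstep : invSqrtStep a t * ‖value ω (T e)‖ ≤ ‖T x‖ := by
    have := norm_value_le ω (T x)
    rwa [hTx, norm_smul, Complex.norm_of_nonneg (invSqrtStep_pos a t).le] at this
  rw [div_mul_eq_mul_div, le_div_iff₀' (Real.exp_pos _)]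
  calc Real.exp (a - 1) * ‖value ω (T e)‖ ≤ invSqrtStep a t * √t * ‖value ω (T e)‖ := by
        gcongr; exact exp_le_invSqrtStep_mul_sqrt a ht
    _ = invSqrtStep a t * ‖value ω (T e)‖ * √t := mul_right_comm _ _ _
    _ ≤ ‖T x‖ * √t := by gcongr

theorem IsLocalMap.exists_norm_value_map_le_sqrt [CompleteSpace E]
    (hT : IsLocalMap C₀(Ω, ℂ) T) (e : E) :
    ∃ M : ℝ, ∀ ω : Ω, ‖value ω (T e)‖ ≤ M * √‖value ω e‖ := by
  choose M hM using fun a => hT.exists_norm_value_map_le_sqrt_of_eventually_const a e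
  refine ⟨max (M 0) (M (1 / 2)), fun ω => ?_⟩
  by_cases hω : ω ∈ closure {x | value x e ≠ 0}
  · refine closure_minimal (fun x hx => ?_) (isClosed_le (continuous_norm_value (T e))
      ((continuous_norm_value e).sqrt.const_mul _)) hω
    obtain ⟨a, rfl | rfl, hconst⟩ := invSqrtStep_eventually_const (norm_pos_iff.2 hx)
    · refine (hM _ x hx hconst).trans ?_
      gcongr
      exact le_max_left _ _
    · refine (hM _ x hx hconst).trans ?_
      gcongr
      exact le_max_right _ _
  · have hzero : ∀ᶠ x in 𝓝 ω, value x e = value x 0 := by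
      filter_upwards [isClosed_closure.isOpen_compl.mem_nhds hω] with x hx
      rw [map_zero]
      exact not_not.1 fun h => hx (subset_closure h)
    rw [hT.value_map_congr hzero, hzero.self_of_nhds]
    simp

theorem IsLocalMap.value_map_eq_zero [CompleteSpace E] (hT : IsLocalMap C₀(Ω, ℂ) T) {ω : Ω} (e : E)
    (he : value ω e = 0) : value ω (T e) = 0 := by
  obtain ⟨M, hM⟩ := hT.exists_norm_value_map_le_sqrt e
  simpa [he] using hM ω

theorem IsLocalMap.isBoundedModuleMap [CompleteSpace E] [CompleteSpace F]
    (hT : IsLocalMap C₀(Ω, ℂ) T) (horth : IsOrthogonalityPreserving C₀(Ω, ℂ) T) :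
    IsBoundedModuleMap C₀(Ω, ℂ) T :=
  isBoundedModuleMap_of_norm_value_le fun _ =>
    let ⟨c, _, hc⟩ := horth.exists_norm_value_map_eq_mul hT.value_map_eq_zero
    ⟨c, fun e => (hc e).le⟩

end LocallyCompact

end HilbertC0

theorem theorem3p5 {Ω E F : Type*} [TopologicalSpace Ω] [LocallyCompactSpace Ω] [T2Space Ω]
    [NormedAddCommGroup E] [NormedSpace ℂ E] [CompleteSpace E]
    [SMul C₀(Ω, ℂ) E] [CStarModule C₀(Ω, ℂ) E]
    [NormedAddCommGroup F] [NormedSpace ℂ F] [CompleteSpace F]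
    [SMul C₀(Ω, ℂ) F] [CStarModule C₀(Ω, ℂ) F]
    (θ : E →ₗ[ℂ] F)
    (hlocal : HilbertC0.IsLocalMap C₀(Ω, ℂ) θ)
    (horth : HilbertC0.IsOrthogonalityPreserving C₀(Ω, ℂ) θ) :
    HilbertC0.IsBoundedModuleMap C₀(Ω, ℂ) θ ∧
    (∃ φ : Ω → ℝ, (∃ C : ℝ, ∀ ω, φ ω ≤ C) ∧ (∀ ω, 0 ≤ φ ω) ∧
      ContinuousOn φ (HilbertC0.nonzeroFibres Ω E) ∧
      ∀ (e g : E) (ω : Ω),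
        inner C₀(Ω, ℂ) (θ e) (θ g) ω = (φ ω : ℂ) * inner C₀(Ω, ℂ) e g ω) ∧
    (∃ (ψ₀ : HilbertC0.nonzeroSet Ω θ →ᵇ ℝ)
      (J : HilbertC0.restrict E (HilbertC0.nonzeroSet Ω θ) →ₗ[ℂ]
        HilbertC0.restrict F (HilbertC0.nonzeroSet Ω θ)),
      (∀ ω, 0 < ψ₀ ω) ∧
      HilbertC0.IsBoundedModuleMap C₀(HilbertC0.nonzeroSet Ω θ, ℂ) J ∧
      ∀ ω : HilbertC0.nonzeroSet Ω θ,
        ∃ Jω : HilbertC0.Fibre E (ω : Ω) →ₗᵢ[ℂ] HilbertC0.Fibre F (ω : Ω),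
          (∀ g : HilbertC0.restrict E (HilbertC0.nonzeroSet Ω θ),
            Jω (HilbertC0.value (ω : Ω) (g : E)) = HilbertC0.value (ω : Ω) (J g : F)) ∧
          ∀ e : E, HilbertC0.value (ω : Ω) (θ e) =
            (ψ₀ ω : ℂ) • Jω (HilbertC0.value (ω : Ω) e)) := by
  open HilbertC0 in
  have hT : IsBoundedModuleMap C₀(Ω, ℂ) θ := hlocal.isBoundedModuleMap horth
  obtain ⟨ψ, hψ0, ⟨C, hψC⟩, hψ⟩ := hT.exists_scaling horth
  have hψc : ContinuousOn ψ (nonzeroFibres Ω E) := continuousOn_of_norm_value_map_eq hψ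
  refine ⟨hT, ⟨fun ω => ψ ω ^ 2, ⟨C ^ 2, fun ω => pow_le_pow_left₀ (hψ0 ω) (hψC ω) 2⟩,
    fun ω => sq_nonneg _, hψc.pow 2, fun e g ω => ?_⟩, ?_⟩
  · rw [inner_map_map_apply_of_norm_eq (hψ ω), Complex.ofReal_pow]
  have hpos : ∀ ω ∈ nonzeroSet Ω θ, 0 < ψ ω := fun ω ⟨e, he⟩ =>
    pos_of_mul_pos_left ((norm_pos_iff.2 he).trans_eq (hψ ω e)) (norm_nonneg _)
  have hψU : ContinuousOn ψ (nonzeroSet Ω θ) :=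
    hψc.mono (nonzeroSet_subset_nonzeroFibres fun _ => hlocal.value_map_eq_zero)
  obtain ⟨J, hJ, hJθ⟩ := hT.exists_restrict_smul (k := fun ω => (ψ ω : ℂ)⁻¹)
    ((Complex.continuous_ofReal.comp_continuousOn hψU).inv₀ fun ω hω =>
      Complex.ofReal_ne_zero.2 (hpos ω hω).ne') zero_le_one fun ω e => by
    rw [norm_smul, hψ, norm_inv, Complex.norm_of_nonneg (hψ0 ω), ← mul_assoc]
    exact mul_le_mul_of_nonneg_right inv_mul_le_one (norm_nonneg _)
  refine ⟨.ofNormedAddCommGroup (fun ω => ψ ω) hψU.domRestrict C fun ω =>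
    (Real.norm_of_nonneg (hψ0 ω)).trans_le (hψC ω), J, fun ω => hpos ω ω.2, hJ, fun ω => ?_⟩
  obtain ⟨V, hV⟩ := exists_linearIsometry_of_norm_eq (hpos ω ω.2) (hψ ω)
  exact ⟨V, fun g => by rw [hJθ, hV, inv_smul_smul₀ (Complex.ofReal_ne_zero.2 (hpos ω ω.2).ne')],
    hV⟩
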